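/- All graphs are finite and simple. A clique of a graph is a maximal complete subgraph, and the clique graph $K(G)$ is the intersection graph of the cliques of $G$; $K^2(G)=K(K(G))$. Let $G$ be a connected graph with maximum degree $\Delta(G)\le 4$ that is not isomorphic to the graph of the octahedron $K_{2,2,2}$. Suppose that $Q_1,\dots,Q_6$ are six distinct vertices of $K^2(G)$ such that $Q_1,Q_2,Q_3$ are pairwise adjacent, $Q_4$ is adjacent to $Q_1$ and $Q_2$, $Q_5$ is adjacent to $Q_2$ and $Q_3$, and $Q_6$ is adjacent to $Q_1$ and $Q_3$ (the subgraph need not be induced). Then at least one of the edges $Q_4Q_3$, $Q_5Q_1$, $Q_6Q_2$ is present in $K^2(G)$. Consequently, $K^2(G)$ is hereditary clique-Helly: for every induced subgraph $H$ of $K^2(G)$, every nonempty family of pairwise intersecting cliques of $H$ has a vertex in common. -/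

import Mathlib

namespace CliqueOperator

universe u

/-- A clique of `G` is a maximal complete subgraph, given by its (nonempty) vertex set.
Nonemptiness only matters for the graph without vertices, which has no cliques. -/
def IsCliqueOf {V : Type u} (G : SimpleGraph V) (q : Set V) : Prop :=
  q.Nonempty ∧ Maximal G.IsClique q

/-- The type of cliques of `G`. -/
abbrev Clique {V : Type u} (G : SimpleGraph V) : Type u :=
  {q : Set V // IsCliqueOf G q}

/-- The clique graph `K(G)`: the intersection graph of the cliques of `G`. -/
def cliqueGraph {V : Type u} (G : SimpleGraph V) : SimpleGraph (Clique G) where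
  Adj p q := p ≠ q ∧ (p.1 ∩ q.1).Nonempty
  symm := ⟨fun p q h => ⟨h.1.symm, by rw [Set.inter_comm]; exact h.2⟩⟩
  loopless := ⟨fun _ h => h.1 rfl⟩

/-- The second iterated clique graph `K²(G) = K(K(G))`. -/
abbrev cliqueGraph2 {V : Type u} (G : SimpleGraph V) : SimpleGraph (Clique (cliqueGraph G)) :=
  cliqueGraph (cliqueGraph G)

/-- The Helly property of a collection of sets: every nonempty subcollection whose members
pairwise meet has a common element. -/
def HasHellyProperty {V : Type u} (C : Set (Set V)) : Prop :=
  ∀ F ⊆ C, F.Nonempty → (∀ p ∈ F, ∀ q ∈ F, (p ∩ q).Nonempty) → (⋂₀ F).Nonempty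

/-- `G` is (clique-)Helly if the collection of its cliques has the Helly property. -/
def IsHelly {V : Type u} (G : SimpleGraph V) : Prop :=
  HasHellyProperty {q : Set V | IsCliqueOf G q}

/-- `G` is hereditary (clique-)Helly if all its induced subgraphs are Helly. -/
def IsHereditaryHelly {V : Type u} (G : SimpleGraph V) : Prop :=
  ∀ S : Set V, IsHelly (G.induce S)

/-- The graph of the octahedron, `K_{2,2,2}`. -/
abbrev octahedron : SimpleGraph (Fin 3 × Fin 2) :=
  SimpleGraph.completeEquipartiteGraph 3 2

/-- The Hajós graph (solid edges): the triangle `0, 1, 2`, with `3` attached to the edge `01`,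
`4` attached to the edge `12` and `5` attached to the edge `02`. -/
def hajosGraph : SimpleGraph (Fin 6) :=
  SimpleGraph.fromEdgeSet
    {s(0, 1), s(1, 2), s(0, 2), s(3, 0), s(3, 1), s(4, 1), s(4, 2), s(5, 0), s(5, 2)}

end CliqueOperator

/-! Call the triangle `a b c` of a `Neck` its core. Under the degree bound a neck is rigid: `b`,
`c`, `b'`, `c'` are all the neighbours of `a`, and likewise at `b` and `c` (`Neck.eq_of_adj`).
Pairwise meeting cliques without a common vertex always produce a neck. Hence a clique of K(G) is a
star or a necktie (`exists_isStar_or_isNecktie`): otherwise the tips of a neck would form a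
triangle, and connectedness would make G the octahedron.

Adjacency in K²(G) means sharing a clique of G, and this becomes incidence in G: a star meets
whatever touches its centre, a necktie touches exactly the six vertices of its neck, and it meets
everything centred at one of them (`IsNecktie.inter_nonempty_of_isCenter`).

Suppose three pairwise meeting vertices of K²(G) have tips that all miss the opposite vertex, and
count the neckties among the three. With none, the centres of the stars and of the tips form a neck
of G, which maximality of the stars closes to an octahedron. With one, a tip meeting both stars
meets the necktie. With more, neckties whose cores share an edge are excluded, as they are met by
the same tips; so their cores share one vertex and span opposite edges of its link. A star meeting
two such neckties sits at the shared vertex and meets whatever meets both; and a necktie has at most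
one partner in such a position, so three neckties are impossible.

Failure of the Helly property in an induced subgraph of K²(G) would itself give a neck in K²(G),
which the Hajós statement forbids. -/

namespace CliqueOperator

universe u

variable {V : Type u} {G : SimpleGraph V}

/-- Two elements of a triangle `a b c` (at least) lie in `q`. -/
def MeetsTwice (q : Set V) (a b c : V) : Prop :=
  (a ∈ q ∧ b ∈ q) ∨ (b ∈ q ∧ c ∈ q) ∨ (a ∈ q ∧ c ∈ q)

/-- Every vertex has at most four neighbours. -/
def DegreeLeFour (G : SimpleGraph V) : Prop :=
  ∀ v (s : Finset V), (∀ x ∈ s, G.Adj v x) → s.card ≤ 4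

/-- A triangle `a b c` with triangles attached to its three edges, whose tips `a' b' c'` are not
adjacent to the opposite vertices. -/
structure Neck (G : SimpleGraph V) (a b c a' b' c' : V) : Prop where
  ab : G.Adj a b
  bc : G.Adj b c
  ac : G.Adj a c
  a'b : G.Adj a' b
  a'c : G.Adj a' c
  b'a : G.Adj b' a
  b'c : G.Adj b' c
  c'a : G.Adj c' a
  c'b : G.Adj c' b
  naa' : ¬ G.Adj a a'
  nbb' : ¬ G.Adj b b'
  ncc' : ¬ G.Adj c c'
  aa' : a ≠ a'
  bb' : b ≠ b'
  cc' : c ≠ c'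

/-- No neck of `G` closes up to an octahedron. -/
def NoOctahedron (G : SimpleGraph V) : Prop :=
  ∀ a b c a' b' c', Neck G a b c a' b' c' →
    ¬ (G.Adj a' b' ∧ G.Adj b' c' ∧ G.Adj a' c')

theorem Neck.rotate {a b c a' b' c' : V} (h : Neck G a b c a' b' c') : Neck G b c a b' c' a' :=
  ⟨h.bc, h.ac.symm, h.ab.symm, h.b'c, h.b'a, h.c'b, h.c'a, h.a'b, h.a'c, h.nbb', h.ncc', h.naa',
    h.bb', h.cc', h.aa'⟩

theorem Neck.swap {a b c a' b' c' : V} (h : Neck G a b c a' b' c') : Neck G a c b a' c' b' :=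
  ⟨h.ac, h.bc.symm, h.ab, h.a'c, h.a'b, h.c'a, h.c'b, h.b'a, h.b'c, h.naa', h.ncc', h.nbb',
    h.aa', h.cc', h.bb'⟩

theorem Neck.eq_of_adj (hd : DegreeLeFour G) {a b c a' b' c' x : V} (h : Neck G a b c a' b' c')
    (hx : G.Adj a x) : x = b ∨ x = c ∨ x = b' ∨ x = c' := by
  classical
  by_contra! hne
  have h1 := hd a {x, b, c, b', c'} (by
    have := h.ab; have := h.ac; have := h.b'a.symm; have := h.c'a.symm
    simp only [Finset.mem_insert, Finset.mem_singleton]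
    rintro y (rfl | rfl | rfl | rfl | rfl) <;> assumption)
  have hbc := h.bc.ne
  have hbc' := h.c'b.ne'
  have hcb' := h.b'c.ne'
  have hb'c' : b' ≠ c' := by
    rintro rfl
    exact h.ncc' h.b'c.symm
  have h2 := h.bb'
  have h3 := h.cc'
  rw [Finset.card_insert_of_notMem (by simp [hne]),
    Finset.card_insert_of_notMem (by simp [*]), Finset.card_insert_of_notMem (by simp [*]),
    Finset.card_insert_of_notMem (by simp [*]), Finset.card_singleton] at h1
  omega

/-! ### Cliques, and necks from failures of the Helly property -/

theorem Clique.adj (q : Clique G) {x y : V} (hx : x ∈ q.1) (hy : y ∈ q.1) (h : x ≠ y) :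
    G.Adj x y :=
  q.2.2.prop hx hy h

theorem Clique.mem_of_forall_adj (q : Clique G) {x : V}
    (h : ∀ y ∈ q.1, y ≠ x → G.Adj x y) : x ∈ q.1 := by
  have h1 : G.IsClique (insert x q.1) :=
    q.2.2.prop.insert fun y hy hne => h y hy hne.symm
  exact q.2.2.le_of_ge h1 (Set.subset_insert _ _) (Set.mem_insert _ _)

theorem exists_clique_superset [Finite V] {s : Set V} (hs : s.Nonempty) (h : G.IsClique s) :
    ∃ q : Clique G, s ⊆ q.1 := by
  obtain ⟨q, hsq, hq⟩ := (Set.toFinite {t : Set V | G.IsClique t}).exists_le_maximal h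
  exact ⟨⟨q, hs.mono hsq, hq⟩, hsq⟩

theorem exists_clique_pair [Finite V] {x y : V} (h : x = y ∨ G.Adj x y) :
    ∃ q : Clique G, x ∈ q.1 ∧ y ∈ q.1 := by
  obtain ⟨q, hq⟩ := exists_clique_superset (G := G) (s := {x, y}) ⟨x, by simp⟩ (by
    rw [SimpleGraph.isClique_pair]; exact fun hne => h.resolve_left hne)
  exact ⟨q, hq (by simp), hq (by simp)⟩

theorem exists_clique_triple [Finite V] {x y z : V} (hxy : G.Adj x y) (hyz : G.Adj y z)
    (hxz : G.Adj x z) : ∃ q : Clique G, x ∈ q.1 ∧ y ∈ q.1 ∧ z ∈ q.1 := by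
  obtain ⟨q, hq⟩ := exists_clique_superset (G := G) (s := {x, y, z}) ⟨x, by simp⟩ (by
    rw [SimpleGraph.isClique_insert, SimpleGraph.isClique_pair]
    refine ⟨fun _ => hyz, ?_⟩
    rintro w (rfl | rfl) _ <;> assumption)
  exact ⟨q, hq (by simp), hq (by simp), hq (by simp)⟩

/-- A pairwise intersecting family of cliques without a common vertex produces a Hajós subgraph
none of whose tips is adjacent to the opposite vertex. -/
theorem exists_neck_of_sInter_eq_empty [Finite V] {F : Set (Set V)}
    (hF : ∀ q ∈ F, IsCliqueOf G q) (hne : F.Nonempty)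
    (hpair : ∀ p ∈ F, ∀ q ∈ F, (p ∩ q).Nonempty) (hempty : ¬ (⋂₀ F).Nonempty) :
    ∃ a b c a' b' c', Neck G a b c a' b' c' ∧
      (∃ q ∈ F, b ∈ q ∧ c ∈ q ∧ a' ∈ q) ∧ (∃ q ∈ F, a ∈ q ∧ c ∈ q ∧ b' ∈ q) ∧
      (∃ q ∈ F, a ∈ q ∧ b ∈ q ∧ c' ∈ q) := by
  -- In a minimal subfamily without a common vertex, each member is avoided by some vertex common to
  -- all the others.
  obtain ⟨E, hEF, hE⟩ :=
    (Set.toFinite {E : Set (Set V) | E ⊆ F ∧ ¬ (⋂₀ E).Nonempty}).exists_le_minimal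
      (show F ∈ _ from ⟨subset_rfl, hempty⟩)
  have hEF : E ⊆ F := hEF
  have hinter := hE.prop.2
  have hpick : ∀ p ∈ E, ∃ x, x ∉ p ∧ ∀ q ∈ E, q ≠ p → x ∈ q := by
    intro p hp
    have h1 : (⋂₀ (E \ {p})).Nonempty := by
      by_contra hcon
      have := hE.le_of_le (y := E \ {p}) ⟨Set.sdiff_subset.trans hEF, hcon⟩ Set.sdiff_subset hp
      exact this.2 rfl
    obtain ⟨x, hx⟩ := h1
    refine ⟨x, fun hxp => hinter ⟨x, fun q hq => ?_⟩, fun q hq hqp => hx q ⟨hq, hqp⟩⟩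
    by_cases hqp : q = p
    · exact hqp ▸ hxp
    · exact hx q ⟨hq, hqp⟩
  obtain ⟨p, hp⟩ : E.Nonempty := by
    by_contra hcon
    rw [Set.not_nonempty_iff_eq_empty] at hcon
    obtain ⟨q, hq⟩ := hne
    obtain ⟨x, hx⟩ := (hF q hq).1
    exact hinter ⟨x, by simp [hcon]⟩
  obtain ⟨q, hq, hqp⟩ : ∃ q ∈ E, q ≠ p := by
    by_contra! hcon
    obtain ⟨x, hx⟩ := (hF p (hEF hp)).1
    exact hinter ⟨x, fun q hq => hcon q hq ▸ hx⟩
  obtain ⟨r, hr, hrp, hrq⟩ : ∃ r ∈ E, r ≠ p ∧ r ≠ q := by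
    by_contra! hcon
    obtain ⟨x, hxp, hxq⟩ := hpair p (hEF hp) q (hEF hq)
    refine hinter ⟨x, fun r hr => ?_⟩
    by_cases hrp : r = p
    · exact hrp ▸ hxp
    · exact hcon r hr hrp ▸ hxq
  obtain ⟨a, hap, ha⟩ := hpick p hp
  obtain ⟨b, hbq, hb⟩ := hpick q hq
  obtain ⟨c, hcr, hc⟩ := hpick r hr
  have hbp := hb p hp hqp.symm
  have hcp := hc p hp hrp.symm
  have haq := ha q hq hqp
  have hcq := hc q hq hrq.symm
  have har := ha r hr hrp
  have hbr := hb r hr hrq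
  -- A vertex outside a maximal complete set has a non-neighbour in it; this supplies the tips.
  have htip : ∀ s ∈ E, ∀ x ∉ s, ∃ y ∈ s, ¬ G.Adj x y ∧ x ≠ y := by
    intro s hs x hx
    by_contra! hcon
    exact hx (Clique.mem_of_forall_adj ⟨s, hF s (hEF hs)⟩ fun y hy hyx => by
      by_contra hadj
      exact hyx (hcon y hy hadj).symm)
  obtain ⟨a', ha', haa', naa'⟩ := htip p hp a hap
  obtain ⟨b', hb', hbb', nbb'⟩ := htip q hq b hbq
  obtain ⟨c', hc', hcc', ncc'⟩ := htip r hr c hcr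
  have hcl : ∀ s ∈ E, ∀ {x y}, x ∈ s → y ∈ s → x ≠ y → G.Adj x y := fun s hs {x y} hx hy =>
    (hF s (hEF hs)).2.prop hx hy
  have ab : G.Adj a b := hcl r hr har hbr (by rintro rfl; exact hap hbp)
  have bc : G.Adj b c := hcl p hp hbp hcp (by rintro rfl; exact hbq hcq)
  have ac : G.Adj a c := hcl q hq haq hcq (by rintro rfl; exact hap hcp)
  refine ⟨a, b, c, a', b', c', ⟨ab, bc, ac, hcl p hp ha' hbp ?_, hcl p hp ha' hcp ?_,
    hcl q hq hb' haq ?_, hcl q hq hb' hcq ?_, hcl r hr hc' har ?_, hcl r hr hc' hbr ?_,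
    haa', hbb', hcc', naa', nbb', ncc'⟩, ⟨p, hEF hp, hbp, hcp, ha'⟩, ⟨q, hEF hq, haq, hcq, hb'⟩,
    ⟨r, hEF hr, har, hbr, hc'⟩⟩
  · rintro rfl; exact haa' ab
  · rintro rfl; exact haa' ac
  · rintro rfl; exact hbb' ab.symm
  · rintro rfl; exact hbb' bc
  · rintro rfl; exact hcc' ac.symm
  · rintro rfl; exact hcc' bc.symm

theorem isHereditaryHelly_of_hajos [Finite V]
    (h : ∀ Q : SimpleGraph.Copy hajosGraph G, G.Adj (Q 3) (Q 2) ∨ G.Adj (Q 4) (Q 0) ∨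
      G.Adj (Q 5) (Q 1)) : IsHereditaryHelly G := by
  intro S F hF hne hpair
  by_contra hempty
  obtain ⟨a, b, c, a', b', c', hn, -⟩ := exists_neck_of_sInter_eq_empty hF hne hpair hempty
  obtain ⟨ab, bc, ac, a'b, a'c, b'a, b'c, c'a, c'b, naa', nbb', ncc', haa', hbb', hcc'⟩ := hn
  have hab' : a' ≠ b' := by rintro rfl; exact naa' b'a.symm
  have hac' : a' ≠ c' := by rintro rfl; exact naa' c'a.symm
  have hbc' : b' ≠ c' := by rintro rfl; exact nbb' c'b.symm
  -- In `hajosGraph` vertex 3 sits over the edge 01, so `c'` comes first among the tips.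
  have hinj : Function.Injective ![a, b, c, c', a', b'] := by
    have := ab.ne; have := bc.ne; have := ac.ne; have := a'b.ne; have := a'c.ne
    have := b'a.ne; have := b'c.ne; have := c'a.ne; have := c'b.ne
    intro i j hij
    fin_cases i <;> fin_cases j <;> first | rfl | (exfalso; simp at hij; grind)
  let f : hajosGraph →g G :=
    { toFun := fun i => (![a, b, c, c', a', b'] i).1
      map_rel' := by
        intro i j hij
        have key : (G.induce S).Adj (![a, b, c, c', a', b'] i) (![a, b, c, c', a', b'] j) := by
          revert hij
          fin_cases i <;> fin_cases j <;> intro hij <;>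
            first
            | assumption
            | (apply SimpleGraph.Adj.symm; assumption)
            | (exfalso; revert hij; simp [hajosGraph])
        exact key }
  have hf : Function.Injective f := fun i j hij => hinj (Subtype.ext hij)
  rcases h ⟨f, hf⟩ with h | h | h
  · exact ncc' (SimpleGraph.Adj.symm h)
  · exact naa' (SimpleGraph.Adj.symm h)
  · exact nbb' (SimpleGraph.Adj.symm h)

/-! ### The degree bound and the excluded octahedron -/

theorem degreeLeFour_of_maxDegree_le [Fintype V] [DecidableRel G.Adj] (h : G.maxDegree ≤ 4) :
    DegreeLeFour G := by
  intro v s hs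
  have h1 : s ⊆ G.neighborFinset v := fun x hx => by simpa using hs x hx
  exact (Finset.card_le_card h1).trans
    ((G.card_neighborFinset_eq_degree v).le.trans ((G.degree_le_maxDegree v).trans h))

/-- When the tips form a triangle, they are the core of a neck with tips `a`, `b`, `c`. Rigidity of
both necks closes the six vertices under adjacency, so by connectedness they are all of G. -/
theorem noOctahedron_of_not_iso (hd : DegreeLeFour G) (hconn : G.Connected)
    (hoct : ¬ Nonempty (G ≃g octahedron)) : NoOctahedron G := by
  rintro a b c a' b' c' hn ⟨h1, h2, h3⟩
  apply hoct
  have hn' : Neck G a' b' c' a b c :=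
    ⟨h1, h2, h3, hn.b'a.symm, hn.c'a.symm, hn.a'b.symm, hn.c'b.symm, hn.a'c.symm, hn.b'c.symm,
      fun h => hn.naa' h.symm, fun h => hn.nbb' h.symm, fun h => hn.ncc' h.symm,
      hn.aa'.symm, hn.bb'.symm, hn.cc'.symm⟩
  have hclosed : ∀ x y, G.Adj x y → x ∈ ({a, b, c, a', b', c'} : Set V) →
      y ∈ ({a, b, c, a', b', c'} : Set V) := by
    intro x y hxy hx
    simp only [Set.mem_insert_iff, Set.mem_singleton_iff] at hx ⊢
    rcases hx with rfl | rfl | rfl | rfl | rfl | rfl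
    · have := hn.eq_of_adj hd hxy; tauto
    · have := hn.rotate.eq_of_adj hd hxy; tauto
    · have := hn.rotate.rotate.eq_of_adj hd hxy; tauto
    · have := hn'.eq_of_adj hd hxy; tauto
    · have := hn'.rotate.eq_of_adj hd hxy; tauto
    · have := hn'.rotate.rotate.eq_of_adj hd hxy; tauto
  have hall : ∀ x, x ∈ ({a, b, c, a', b', c'} : Set V) := by
    intro x
    obtain ⟨w⟩ := hconn.preconnected a x
    have : ∀ {y z : V}, G.Walk y z → y ∈ ({a, b, c, a', b', c'} : Set V) →
        z ∈ ({a, b, c, a', b', c'} : Set V) := by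
      intro y z w
      induction w with
      | nil => exact id
      | cons h _ ih => exact fun hy => ih (hclosed _ _ h hy)
    exact this w (by simp)
  let g : Fin 3 × Fin 2 → V := fun p => ![![a, a'], ![b, b'], ![c, c']] p.1 p.2
  obtain ⟨ab, bc, ac, a'b, a'c, b'a, b'c, c'a, c'b, naa', nbb', ncc', haa', hbb', hcc'⟩ := hn
  have hadj : ∀ p q : Fin 3 × Fin 2, p.1 ≠ q.1 → G.Adj (g p) (g q) := by
    rintro ⟨i, k⟩ ⟨j, l⟩ hij
    fin_cases i <;> fin_cases j <;> fin_cases k <;> fin_cases l <;>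
      first
      | exact absurd rfl hij
      | assumption
      | (apply SimpleGraph.Adj.symm; assumption)
  have hnadj : ∀ p q : Fin 3 × Fin 2, p.1 = q.1 → ¬ G.Adj (g p) (g q) := by
    rintro ⟨i, k⟩ ⟨j, l⟩ hij
    obtain rfl : i = j := hij
    fin_cases i <;> fin_cases k <;> fin_cases l <;>
      first
      | exact G.loopless.irrefl _
      | assumption
      | (rw [SimpleGraph.adj_comm]; assumption)
  have hinj : Function.Injective g := by
    rintro ⟨i, k⟩ ⟨j, l⟩ hij
    by_cases h : i = j
    · subst h
      fin_cases i <;> fin_cases k <;> fin_cases l <;>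
        first
        | rfl
        | exact absurd hij (by assumption)
        | exact absurd hij.symm (by assumption)
    · exact absurd hij (hadj ⟨i, k⟩ ⟨j, l⟩ h).ne
  have hsurj : Function.Surjective g := by
    intro x
    have := hall x
    simp only [Set.mem_insert_iff, Set.mem_singleton_iff] at this
    rcases this with rfl | rfl | rfl | rfl | rfl | rfl
    exacts [⟨(0, 0), rfl⟩, ⟨(1, 0), rfl⟩, ⟨(2, 0), rfl⟩, ⟨(0, 1), rfl⟩, ⟨(1, 1), rfl⟩,
      ⟨(2, 1), rfl⟩]
  let e : octahedron ≃g G :=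
    { toEquiv := Equiv.ofBijective g ⟨hinj, hsurj⟩
      map_rel_iff' := by
        intro p q
        simp only [SimpleGraph.completeEquipartiteGraph_adj]
        exact ⟨fun h hpq => hnadj p q hpq h, hadj p q⟩ }
  exact ⟨e.symm⟩

/-! ### Stars and neckties -/

/-- `Q` consists of the cliques of `G` through the vertex `v`. -/
def IsStar (Q : Clique (cliqueGraph G)) (v : V) : Prop :=
  ∀ q : Clique G, q ∈ Q.1 ↔ v ∈ q.1

/-- `Q` consists of the cliques of `G` through at least two vertices of the triangle `a b c` of a
neck. -/
structure IsNecktie (Q : Clique (cliqueGraph G)) (a b c a' b' c' : V) : Prop where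
  neck : Neck G a b c a' b' c'
  mem_iff : ∀ q : Clique G, q ∈ Q.1 ↔ MeetsTwice q.1 a b c

theorem IsNecktie.rotate {Q : Clique (cliqueGraph G)} {a b c a' b' c' : V}
    (h : IsNecktie Q a b c a' b' c') : IsNecktie Q b c a b' c' a' :=
  ⟨h.neck.rotate, fun q => by rw [h.mem_iff]; unfold MeetsTwice; tauto⟩

theorem IsNecktie.swap {Q : Clique (cliqueGraph G)} {a b c a' b' c' : V}
    (h : IsNecktie Q a b c a' b' c') : IsNecktie Q a c b a' c' b' :=
  ⟨h.neck.swap, fun q => by rw [h.mem_iff]; unfold MeetsTwice; tauto⟩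

theorem inter_nonempty_of_mem {Q : Clique (cliqueGraph G)} {p q : Clique G} (hp : p ∈ Q.1)
    (hq : q ∈ Q.1) : (p.1 ∩ q.1).Nonempty := by
  by_cases h : p = q
  · rw [h, Set.inter_self]
    exact q.2.1
  · exact (Clique.adj Q hp hq h).2

theorem mem_of_forall_inter_nonempty {Q : Clique (cliqueGraph G)} {q : Clique G}
    (h : ∀ p ∈ Q.1, (q.1 ∩ p.1).Nonempty) : q ∈ Q.1 :=
  Clique.mem_of_forall_adj Q fun p hp hpq => ⟨hpq.symm, h p hp⟩

/-- Every vertex of `K²(G)` is a star or a necktie. -/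
theorem exists_isStar_or_isNecktie [Finite V] (hd : DegreeLeFour G) (hO : NoOctahedron G)
    (Q : Clique (cliqueGraph G)) :
    (∃ v, IsStar Q v) ∨ ∃ a b c a' b' c', IsNecktie Q a b c a' b' c' := by
  by_cases hcommon : ∃ v, ∀ q ∈ Q.1, v ∈ q.1
  · obtain ⟨v, hv⟩ := hcommon
    exact Or.inl ⟨v, fun q => ⟨hv q, fun hq => mem_of_forall_inter_nonempty
      fun p hp => ⟨v, hq, hv p hp⟩⟩⟩
  right
  obtain ⟨a, b, c, a', b', c', hn, ⟨p, hp, hbp, hcp, hap⟩, ⟨q, hq, haq, hcq, hbq⟩,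
      ⟨r, hr, har, hbr, hcr⟩⟩ := exists_neck_of_sInter_eq_empty (G := G) (F := Subtype.val '' Q.1)
    (by rintro _ ⟨q, -, rfl⟩; exact q.2) (Q.2.1.image _)
    (by
      rintro _ ⟨p, hp, rfl⟩ _ ⟨q, hq, rfl⟩
      exact inter_nonempty_of_mem hp hq)
    (by
      rintro ⟨v, hv⟩
      exact hcommon ⟨v, fun q hq => hv _ ⟨q, hq, rfl⟩⟩)
  obtain ⟨p, hp, rfl⟩ := hp
  obtain ⟨q, hq, rfl⟩ := hq
  obtain ⟨r, hr, rfl⟩ := hr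
  have key : ∀ s ∈ Q.1, MeetsTwice s.1 a b c := by
    intro s hs
    have h1 : ∀ {x y : V}, x ∈ s.1 → y ∈ s.1 → x = y ∨ G.Adj x y := fun hx hy =>
      or_iff_not_imp_left.2 (s.adj hx hy)
    -- The clique `p` through `b`, `c`, `a'` has no further vertex, since the other neighbours of
    -- `b` are `a` and `c'`. So `s` meets each attached triangle; with fewer than two core vertices
    -- it would contain all three tips or a tip with its opposite vertex.
    have hsub : ∀ {a b c a' b' c' : V} (p : Clique G), Neck G a b c a' b' c' → p ∈ Q.1 →
        b ∈ p.1 → c ∈ p.1 → a' ∈ p.1 → b ∈ s.1 ∨ c ∈ s.1 ∨ a' ∈ s.1 := by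
      intro a b c a' b' c' p hn hp hb hc ha
      obtain ⟨x, hxp, hxs⟩ := inter_nonempty_of_mem hp hs
      by_cases hxb : x = b
      · exact Or.inl (hxb ▸ hxs)
      by_cases hxc : x = c
      · exact Or.inr (Or.inl (hxc ▸ hxs))
      have h2 := p.adj hb hxp (Ne.symm hxb)
      have h3 := p.adj hc hxp (Ne.symm hxc)
      rcases hn.rotate.eq_of_adj hd h2 with rfl | rfl | rfl | rfl
      · exact absurd rfl hxc
      · exact absurd (p.adj hxp ha hn.aa') hn.naa'
      · exact absurd h3 hn.ncc'
      · exact Or.inr (Or.inr hxs)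
    have hA := hsub p hn hp hbp hcp hap
    have hB := hsub q hn.rotate hq hcq haq hbq
    have hC := hsub r hn.rotate.rotate hr har hbr hcr
    have haa : ¬ (a ∈ s.1 ∧ a' ∈ s.1) := fun h => hn.naa' (s.adj h.1 h.2 hn.aa')
    have hbb : ¬ (b ∈ s.1 ∧ b' ∈ s.1) := fun h => hn.nbb' (s.adj h.1 h.2 hn.bb')
    have hcc : ¬ (c ∈ s.1 ∧ c' ∈ s.1) := fun h => hn.ncc' (s.adj h.1 h.2 hn.cc')
    have hoct : ¬ (a' ∈ s.1 ∧ b' ∈ s.1 ∧ c' ∈ s.1) := by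
      rintro ⟨ha, hb, hc⟩
      refine hO _ _ _ _ _ _ hn ⟨s.adj ha hb ?_, s.adj hb hc ?_, s.adj ha hc ?_⟩
      · rintro rfl; exact hn.naa' hn.b'a.symm
      · rintro rfl; exact hn.nbb' hn.c'b.symm
      · rintro rfl; exact hn.naa' hn.c'a.symm
    unfold MeetsTwice
    tauto
  refine ⟨a, b, c, a', b', c', hn, fun s => ⟨key s, fun h => mem_of_forall_inter_nonempty
    fun t ht => ?_⟩⟩
  rcases h with h | h | h <;> rcases key t ht with h' | h' | h' <;>
    first
    | exact ⟨_, h.1, h'.1⟩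
    | exact ⟨_, h.1, h'.2⟩
    | exact ⟨_, h.2, h'.1⟩
    | exact ⟨_, h.2, h'.2⟩

/-! ### Touched vertices and centres -/

/-- Some member of `P` contains the vertex `v`. -/
def Touches (P : Clique (cliqueGraph G)) (v : V) : Prop :=
  ∃ q ∈ P.1, v ∈ q.1

theorem IsStar.inter_nonempty_iff {P Q : Clique (cliqueGraph G)} {v : V} (h : IsStar Q v) :
    (P.1 ∩ Q.1).Nonempty ↔ Touches P v :=
  ⟨fun ⟨q, hP, hQ⟩ => ⟨q, hP, (h q).1 hQ⟩, fun ⟨q, hP, hv⟩ => ⟨q, hP, (h q).2 hv⟩⟩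

theorem IsStar.touches_iff [Finite V] {P : Clique (cliqueGraph G)} {v w : V} (h : IsStar P v) :
    Touches P w ↔ v = w ∨ G.Adj v w := by
  constructor
  · rintro ⟨q, hq, hw⟩
    exact or_iff_not_imp_left.2 (q.adj ((h q).1 hq) hw)
  · intro hvw
    obtain ⟨q, hv, hw⟩ := exists_clique_pair hvw
    exact ⟨q, (h q).2 hv, hw⟩

theorem IsNecktie.touches_iff [Finite V] (hd : DegreeLeFour G) {P : Clique (cliqueGraph G)}
    {a b c a' b' c' v : V} (h : IsNecktie P a b c a' b' c') :
    Touches P v ↔ v = a ∨ v = b ∨ v = c ∨ v = a' ∨ v = b' ∨ v = c' := by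
  have hn := h.neck
  constructor
  · rintro ⟨q, hq, hv⟩
    have h1 : ∀ {x}, x ∈ q.1 → v = x ∨ G.Adj x v := fun {x} hx =>
      or_iff_not_imp_left.2 fun hne => q.adj hx hv (Ne.symm hne)
    rcases (h.mem_iff q).1 hq with h2 | h2 | h2
    · rcases h1 h2.1 with h3 | h3
      · tauto
      · have := hn.eq_of_adj hd h3; tauto
    · rcases h1 h2.1 with h3 | h3
      · tauto
      · have := hn.rotate.eq_of_adj hd h3; tauto
    · rcases h1 h2.1 with h3 | h3
      · tauto
      · have := hn.eq_of_adj hd h3; tauto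
  · have key : ∀ {x y z : V}, G.Adj x y → G.Adj z x → G.Adj z y →
        (∀ q : Clique G, x ∈ q.1 → y ∈ q.1 → MeetsTwice q.1 a b c) →
        Touches P x ∧ Touches P z := by
      intro x y z hxy hzx hzy hm
      obtain ⟨q, hx, hy, hz⟩ := exists_clique_triple hxy hzy.symm hzx.symm
      have hq := (h.mem_iff q).2 (hm q hx hy)
      exact ⟨⟨q, hq, hx⟩, ⟨q, hq, hz⟩⟩
    have hA := key hn.bc hn.a'b hn.a'c fun q hb hc => Or.inr (Or.inl ⟨hb, hc⟩)
    have hB := key hn.ac.symm hn.b'c hn.b'a fun q hc ha => Or.inr (Or.inr ⟨ha, hc⟩)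
    have hC := key hn.ab hn.c'a hn.c'b fun q ha hb => Or.inl ⟨ha, hb⟩
    rintro (rfl | rfl | rfl | rfl | rfl | rfl)
    exacts [hC.1, hA.1, hB.1, hA.2, hB.2, hC.2]

/-- In a necktie every closed neighbourhood of a vertex of the central triangle is touched. -/
theorem IsNecktie.touches_of_adj [Finite V] (hd : DegreeLeFour G) {P : Clique (cliqueGraph G)}
    {a b c a' b' c' v : V} (h : IsNecktie P a b c a' b' c') (hv : a = v ∨ G.Adj a v) :
    Touches P v := by
  rw [h.touches_iff hd]
  rcases hv with hv | hv
  · exact Or.inl hv.symm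
  · have := h.neck.eq_of_adj hd hv
    tauto

/-- This lets a vertex of G stand in for `P`. In a necktie, if `u` or `v` is in the core it serves
itself; two distinct tips have a common neighbour in the core. -/
theorem exists_center [Finite V] (hd : DegreeLeFour G) (hO : NoOctahedron G)
    {P : Clique (cliqueGraph G)} {u v : V} (huv : G.Adj u v) (hu : Touches P u)
    (hv : Touches P v) :
    ∃ y, (y = u ∨ G.Adj y u) ∧ (y = v ∨ G.Adj y v) ∧
      (IsStar P y ∨ ∃ b c a' b' c', IsNecktie P y b c a' b' c') := by
  rcases exists_isStar_or_isNecktie hd hO P with ⟨y, hy⟩ | ⟨a, b, c, a', b', c', h⟩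
  · exact ⟨y, hy.touches_iff.1 hu, hy.touches_iff.1 hv, Or.inl hy⟩
  have ha : ∃ b c a' b' c', IsNecktie P a b c a' b' c' := ⟨_, _, _, _, _, h⟩
  have hb : ∃ a c b' a' c', IsNecktie P b a c b' a' c' := ⟨_, _, _, _, _, h.rotate⟩
  have hc : ∃ b a c' b' a', IsNecktie P c b a c' b' a' := ⟨_, _, _, _, _, h.rotate.rotate⟩
  have hn := h.neck
  have hau := hn.a'b.symm; have hau' := hn.a'c.symm
  have hbu := hn.b'a.symm; have hbu' := hn.b'c.symm
  have hcu := hn.c'a.symm; have hcu' := hn.c'b.symm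
  have huv' := huv.symm
  rw [h.touches_iff hd] at hu hv
  rcases hu with rfl | rfl | rfl | rfl | rfl | rfl
  · exact ⟨_, Or.inl rfl, Or.inr huv, Or.inr ha⟩
  · exact ⟨_, Or.inl rfl, Or.inr huv, Or.inr hb⟩
  · exact ⟨_, Or.inl rfl, Or.inr huv, Or.inr hc⟩
  all_goals
    rcases hv with rfl | rfl | rfl | rfl | rfl | rfl <;>
    first
    | exact absurd huv (G.loopless.irrefl _)
    | exact ⟨_, Or.inr huv', Or.inl rfl, Or.inr ha⟩
    | exact ⟨_, Or.inr huv', Or.inl rfl, Or.inr hb⟩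
    | exact ⟨_, Or.inr huv', Or.inl rfl, Or.inr hc⟩
    | exact ⟨a, Or.inr (by assumption), Or.inr (by assumption), Or.inr ha⟩
    | exact ⟨b, Or.inr (by assumption), Or.inr (by assumption), Or.inr hb⟩
    | exact ⟨c, Or.inr (by assumption), Or.inr (by assumption), Or.inr hc⟩

theorem touches_of_center [Finite V] (hd : DegreeLeFour G) {P : Clique (cliqueGraph G)} {y w : V}
    (h : IsStar P y ∨ ∃ b c a' b' c', IsNecktie P y b c a' b' c') (hw : y = w ∨ G.Adj y w) :
    Touches P w := by
  rcases h with h | ⟨b, c, a', b', c', h⟩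
  · exact h.touches_iff.2 hw
  · exact h.touches_of_adj hd hw

/-- The star of a vertex of the central triangle of a neck is maximal only if the link of the
vertex is a four-cycle. -/
theorem IsStar.adj_of_neck (hd : DegreeLeFour G) [Finite V] {Q : Clique (cliqueGraph G)}
    {a b c a' b' c' : V} (h : IsStar Q a) (hn : Neck G a b c a' b' c') : G.Adj b' c' := by
  by_contra hnadj
  -- If `b'` and `c'` are not adjacent, every clique through `a` contains `b` or `c`, hence meets
  -- `q`, which misses `a`: the star is not maximal.
  obtain ⟨q, hb, hc, ha'⟩ := exists_clique_triple hn.bc hn.a'c.symm hn.a'b.symm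
  have hq : q ∉ Q.1 := fun hq => hn.naa' (q.adj ((h q).1 hq) ha' hn.aa')
  refine hq (mem_of_forall_inter_nonempty fun p hp => ?_)
  have hap := (h p).1 hp
  by_contra hcon
  have hbp : b ∉ p.1 := fun hbp => hcon ⟨b, hb, hbp⟩
  have hcp : c ∉ p.1 := fun hcp => hcon ⟨c, hc, hcp⟩
  have h1 : ∀ x ∈ p.1, x = a ∨ x = b' ∨ x = c' := by
    intro x hx
    by_cases hxa : x = a
    · exact Or.inl hxa
    · rcases hn.eq_of_adj hd (p.adj hap hx (Ne.symm hxa)) with rfl | rfl | h | h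
      · exact absurd hx hbp
      · exact absurd hx hcp
      · exact Or.inr (Or.inl h)
      · exact Or.inr (Or.inr h)
  have hne : b' ≠ c' := by
    rintro rfl
    exact hn.nbb' hn.c'b.symm
  by_cases hb' : b' ∈ p.1
  · have hc' : c' ∉ p.1 := fun hc' => hnadj (p.adj hb' hc' hne)
    refine hcp (p.mem_of_forall_adj fun x hx _ => ?_)
    rcases h1 x hx with rfl | rfl | rfl
    · exact hn.ac.symm
    · exact hn.b'c.symm
    · exact absurd hx hc'
  · refine hbp (p.mem_of_forall_adj fun x hx _ => ?_)
    rcases h1 x hx with rfl | rfl | rfl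
    · exact hn.ab.symm
    · exact absurd hx hb'
    · exact hn.c'b.symm

/-- No triangle of stars has three tips. -/
theorem not_three_stars [Finite V] (hd : DegreeLeFour G) (hO : NoOctahedron G)
    {Q₁ Q₂ Q₃ : Clique (cliqueGraph G)} {u v w a b c : V} (h₁ : IsStar Q₁ u) (h₂ : IsStar Q₂ v)
    (h₃ : IsStar Q₃ w) (hn : Neck G u v w a b c) : False :=
  hO _ _ _ _ _ _ hn ⟨h₃.adj_of_neck hd hn.rotate.rotate, h₁.adj_of_neck hd hn,
    (h₂.adj_of_neck hd hn.rotate).symm⟩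

/-! ### Which vertices of K²(G) meet a necktie -/

/-- `P` is the star of `y`, or a necktie whose central triangle contains `y`. -/
def IsCenter (P : Clique (cliqueGraph G)) (y : V) : Prop :=
  IsStar P y ∨ ∃ b c a' b' c', IsNecktie P y b c a' b' c'

theorem IsNecktie.exists_pair {P : Clique (cliqueGraph G)} {a b c a' b' c' : V}
    (h : IsNecktie P a b c a' b' c') {q : Clique G} (hq : q ∈ P.1) :
    ∃ x y, x ≠ y ∧ x ∈ q.1 ∧ y ∈ q.1 ∧ IsCenter P x ∧ IsCenter P y := by
  have ha : IsCenter P a := Or.inr ⟨_, _, _, _, _, h⟩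
  have hb : IsCenter P b := Or.inr ⟨_, _, _, _, _, h.rotate⟩
  have hc : IsCenter P c := Or.inr ⟨_, _, _, _, _, h.rotate.rotate⟩
  rcases (h.mem_iff q).1 hq with hm | hm | hm
  · exact ⟨a, b, h.neck.ab.ne, hm.1, hm.2, ha, hb⟩
  · exact ⟨b, c, h.neck.bc.ne, hm.1, hm.2, hb, hc⟩
  · exact ⟨a, c, h.neck.ac.ne, hm.1, hm.2, ha, hc⟩

theorem exists_isCenter_mem [Finite V] (hd : DegreeLeFour G) (hO : NoOctahedron G)
    {P : Clique (cliqueGraph G)} {q : Clique G} (hq : q ∈ P.1) : ∃ y ∈ q.1, IsCenter P y := by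
  rcases exists_isStar_or_isNecktie hd hO P with ⟨y, hy⟩ | ⟨a, b, c, a', b', c', h⟩
  · exact ⟨y, (hy q).1 hq, Or.inl hy⟩
  · obtain ⟨x, -, -, hx, -, hxP, -⟩ := h.exists_pair hq
    exact ⟨x, hx, hxP⟩

theorem IsNecktie.inter_nonempty_of_triple [Finite V] {P Q : Clique (cliqueGraph G)}
    {a b c a' b' c' d e f d' e' f' x y z : V} (hP : IsNecktie P d e f d' e' f')
    (hQ : IsNecktie Q a b c a' b' c') (hxy : G.Adj x y) (hyz : G.Adj y z) (hxz : G.Adj x z)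
    (h1 : ∀ q : Set V, x ∈ q → y ∈ q → z ∈ q → MeetsTwice q d e f)
    (h2 : ∀ q : Set V, x ∈ q → y ∈ q → z ∈ q → MeetsTwice q a b c) : (P.1 ∩ Q.1).Nonempty := by
  obtain ⟨q, hx, hy, hz⟩ := exists_clique_triple hxy hyz hxz
  exact ⟨q, (hP.mem_iff q).2 (h1 _ hx hy hz), (hQ.mem_iff q).2 (h2 _ hx hy hz)⟩

/-- By rigidity the core edge `a e` of `P` lies in a triangle of the neck of `Q` that contains a
core edge of `Q`. A clique through that triangle belongs to both. -/
theorem IsNecktie.inter_nonempty_of_common_center [Finite V] (hd : DegreeLeFour G)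
    {P Q : Clique (cliqueGraph G)} {a b c a' b' c' e f d' e' f' : V}
    (hP : IsNecktie P a e f d' e' f') (hQ : IsNecktie Q a b c a' b' c') :
    (P.1 ∩ Q.1).Nonempty := by
  have hn := hQ.neck
  rcases hn.eq_of_adj hd hP.neck.ab with rfl | rfl | rfl | rfl
  · exact hP.inter_nonempty_of_triple hQ hn.ab hn.bc hn.ac
      (fun q ha hb _ => Or.inl ⟨ha, hb⟩) (fun q ha hb _ => Or.inl ⟨ha, hb⟩)
  · exact hP.inter_nonempty_of_triple hQ hn.ab hn.bc hn.ac
      (fun q ha _ hc => Or.inl ⟨ha, hc⟩) (fun q ha hb _ => Or.inl ⟨ha, hb⟩)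
  · exact hP.inter_nonempty_of_triple hQ hn.b'a.symm hn.b'c hn.ac
      (fun q ha hb _ => Or.inl ⟨ha, hb⟩) (fun q ha _ hc => Or.inr (Or.inr ⟨ha, hc⟩))
  · exact hP.inter_nonempty_of_triple hQ hn.c'a.symm hn.c'b hn.ab
      (fun q ha hb _ => Or.inl ⟨ha, hb⟩) (fun q ha _ hc => Or.inl ⟨ha, hc⟩)

/-- If the cores are disjoint, rigidity at `a'` makes `b` and `c` tips of `P`. Rigidity at `b` and
`c` then makes `b'` and `c'` the rest of the core of `P`, so the tips of `Q` form a triangle. -/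
theorem IsNecktie.inter_nonempty_of_center_eq_tip [Finite V] (hd : DegreeLeFour G)
    (hO : NoOctahedron G) {P Q : Clique (cliqueGraph G)} {a b c a' b' c' e f d' e' f' : V}
    (hP : IsNecktie P a' e f d' e' f') (hQ : IsNecktie Q a b c a' b' c') :
    (P.1 ∩ Q.1).Nonempty := by
  have hn := hQ.neck
  by_contra hcon
  have heb : e ≠ b := by
    rintro rfl
    exact hcon (hP.rotate.inter_nonempty_of_common_center hd hQ.rotate)
  have hec : e ≠ c := by
    rintro rfl
    exact hcon (hP.rotate.inter_nonempty_of_common_center hd hQ.rotate.rotate)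
  have hfb : f ≠ b := by
    rintro rfl
    exact hcon (hP.rotate.rotate.inter_nonempty_of_common_center hd hQ.rotate)
  have hfc : f ≠ c := by
    rintro rfl
    exact hcon (hP.rotate.rotate.inter_nonempty_of_common_center hd hQ.rotate.rotate)
  have key : ∀ {e f d' e' f' : V}, Neck G a' e f d' e' f' → e ≠ b → f ≠ c → b = e' → c = f' →
      False := by
    rintro e f d' e' f' hS he hf rfl rfl
    have hf' : f = c' := by
      rcases hn.rotate.eq_of_adj hd hS.b'c with h | h | h | h
      · exact absurd h hf
      · exact absurd (h ▸ hS.ac.symm) hn.naa'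
      · exact h
      · exact absurd h.symm hS.ac.ne
    have he' : e = b' := by
      rcases hn.rotate.rotate.eq_of_adj hd hS.c'b with h | h | h | h
      · exact absurd (h ▸ hS.ab.symm) hn.naa'
      · exact absurd h he
      · exact absurd h.symm hS.ab.ne
      · exact h
    subst hf' he'
    exact hO _ _ _ _ _ _ hn ⟨hS.ab, hS.bc, hS.ac⟩
  have hbc := hn.bc.ne
  have hb := hP.neck.eq_of_adj hd hn.a'b
  have hc := hP.neck.eq_of_adj hd hn.a'c
  rcases hb with h | h | hb | hb
  · exact heb h.symm
  · exact hfb h.symm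
  · rcases hc with h | h | hc | hc
    · exact hec h.symm
    · exact hfc h.symm
    · exact hbc (hb.trans hc.symm)
    · exact key hP.neck heb hfc hb hc
  · rcases hc with h | h | hc | hc
    · exact hec h.symm
    · exact hfc h.symm
    · exact key hP.neck.swap hfb hec hb hc
    · exact hbc (hb.trans hc.symm)

/-- A vertex of `K²(G)` with a center touched by a necktie is adjacent to the necktie. -/
theorem IsNecktie.inter_nonempty_of_isCenter [Finite V] (hd : DegreeLeFour G)
    (hO : NoOctahedron G) {P Q : Clique (cliqueGraph G)} {a b c a' b' c' y : V}
    (hQ : IsNecktie Q a b c a' b' c') (hP : IsCenter P y) (hy : Touches Q y) :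
    (P.1 ∩ Q.1).Nonempty := by
  rcases hP with hP | ⟨e, f, d', e', f', hP⟩
  · rw [Set.inter_comm]
    exact hP.inter_nonempty_iff.2 hy
  · rcases (hQ.touches_iff hd).1 hy with rfl | rfl | rfl | rfl | rfl | rfl
    · exact hP.inter_nonempty_of_common_center hd hQ
    · exact hP.inter_nonempty_of_common_center hd hQ.rotate
    · exact hP.inter_nonempty_of_common_center hd hQ.rotate.rotate
    · exact hP.inter_nonempty_of_center_eq_tip hd hO hQ
    · exact hP.inter_nonempty_of_center_eq_tip hd hO hQ.rotate
    · exact hP.inter_nonempty_of_center_eq_tip hd hO hQ.rotate.rotate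

/-- The triangle `a' b' c` is the core of a second neck, with tips `a`, `b`, `y`; a star at `a'`
forces its tips `b` and `y` to be adjacent. -/
theorem not_isStar_tip [Finite V] (hd : DegreeLeFour G) {Q : Clique (cliqueGraph G)}
    {a b c a' b' c' y : V} (hn : Neck G a b c a' b' c') (h : IsStar Q a')
    (hab : G.Adj a' b') (hya : G.Adj y a') (hyb : G.Adj y b') (hb : ¬ G.Adj b y)
    (hc : ¬ G.Adj c y) (hcy : c ≠ y) : False :=
  hb (h.adj_of_neck hd (⟨hab, hn.b'c, hn.a'c, hn.b'a.symm, hn.ac, hn.a'b.symm, hn.bc, hya, hyb,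
    fun h => hn.naa' h.symm, fun h => hn.nbb' h.symm, hc, hn.aa'.symm, hn.bb'.symm, hcy⟩ :
    Neck G a' b' c a b y))

/-- A necktie and two stars that meet pairwise: what meets both stars meets the necktie. -/
theorem inter_nonempty_of_two_stars [Finite V] (hd : DegreeLeFour G) (hO : NoOctahedron G)
    {Q Q₂ Q₃ P : Clique (cliqueGraph G)} {a b c a' b' c' u v : V}
    (hQ : IsNecktie Q a b c a' b' c') (h₂ : IsStar Q₂ u) (h₃ : IsStar Q₃ v) (huv : G.Adj u v)
    (hQu : Touches Q u) (hQv : Touches Q v) (hPu : Touches P u) (hPv : Touches P v) :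
    (P.1 ∩ Q.1).Nonempty := by
  by_contra hcon
  -- This centre is not touched by `Q`, so it is neither in nor adjacent to the core. Hence `u` and
  -- `v` are adjacent tips of `Q`, with `y` attached to both.
  obtain ⟨y, hyu, hyv, hy⟩ := exists_center hd hO huv hPu hPv
  have hQy : ¬ Touches Q y := fun h => hcon (hQ.inter_nonempty_of_isCenter hd hO hy h)
  have na : ∀ {x}, (y = x ∨ G.Adj y x) → x ≠ a ∧ x ≠ b ∧ x ≠ c := by
    intro x hx
    refine ⟨?_, ?_, ?_⟩ <;> rintro rfl <;> apply hQy
    · exact hQ.touches_of_adj hd (hx.imp Eq.symm fun h => h.symm)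
    · exact hQ.rotate.touches_of_adj hd (hx.imp Eq.symm fun h => h.symm)
    · exact hQ.rotate.rotate.touches_of_adj hd (hx.imp Eq.symm fun h => h.symm)
  have ya : ¬ G.Adj a y := fun h => (na (Or.inr h.symm)).1 rfl
  have yb : ¬ G.Adj b y := fun h => (na (Or.inr h.symm)).2.1 rfl
  have yc : ¬ G.Adj c y := fun h => (na (Or.inr h.symm)).2.2 rfl
  obtain ⟨ya', yb', yc'⟩ := na (Or.inl rfl)
  have hyu' : G.Adj y u := hyu.resolve_left (by rintro rfl; exact hQy hQu)
  have hyv' : G.Adj y v := hyv.resolve_left (by rintro rfl; exact hQy hQv)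
  obtain ⟨hua, hub, huc⟩ := na hyu
  obtain ⟨hva, hvb, hvc⟩ := na hyv
  have hn := hQ.neck
  rw [hQ.touches_iff hd] at hQu hQv
  rcases hQu with h | h | h | rfl | rfl | rfl
  · exact hua h
  · exact hub h
  · exact huc h
  all_goals
    rcases hQv with h | h | h | rfl | rfl | rfl
    · exact hva h
    · exact hvb h
    · exact hvc h
    all_goals
      first
      | exact absurd huv (G.loopless.irrefl _)
      | exact not_isStar_tip hd hn h₂ huv hyu' hyv' yb yc yc'.symm
      | exact not_isStar_tip hd hn.swap h₂ huv hyu' hyv' yc yb yb'.symm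
      | exact not_isStar_tip hd hn.rotate h₂ huv hyu' hyv' yc ya ya'.symm
      | exact not_isStar_tip hd hn.rotate.swap h₂ huv hyu' hyv' ya yc yc'.symm
      | exact not_isStar_tip hd hn.rotate.rotate h₂ huv hyu' hyv' ya yb yb'.symm
      | exact not_isStar_tip hd hn.rotate.rotate.swap h₂ huv hyu' hyv' yb ya ya'.symm

/-- If two neckties share an edge of their central triangles, what meets one meets the other. -/
theorem inter_nonempty_of_common_edge [Finite V] (hd : DegreeLeFour G) (hO : NoOctahedron G)
    {Q S P : Clique (cliqueGraph G)} {a b c a' b' c' d' e' f' : V}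
    (hQ : IsNecktie Q a b c a' b' c') (hS : IsNecktie S a' b c d' e' f')
    (hPS : (P.1 ∩ S.1).Nonempty) : (P.1 ∩ Q.1).Nonempty := by
  obtain ⟨q, hqP, hqS⟩ := hPS
  obtain ⟨y, hyq, hy⟩ := exists_isCenter_mem hd hO hqP
  refine hQ.inter_nonempty_of_isCenter hd hO hy ?_
  have hyS : Touches S y := ⟨q, hqS, hyq⟩
  have hn := hQ.neck
  have hs := hS.neck
  -- Rigidity at `b` and `c` identifies the tips of `S`: both necks have the same six vertices.
  have hd' : d' = a := by
    rcases hn.rotate.eq_of_adj hd hs.a'b.symm with h | h | h | h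
    · exact absurd h hs.a'c.ne
    · exact h
    · exact absurd (h ▸ hs.a'c.symm) hn.ncc'
    · exact absurd h.symm hs.aa'
  have he' : e' = b' := by
    rcases hn.rotate.rotate.eq_of_adj hd hs.b'c.symm with h | h | h | h
    · exact absurd (h ▸ hs.b'a) hn.naa'
    · exact absurd h.symm hs.bb'
    · exact absurd h hs.b'a.ne
    · exact h
  have hf' : f' = c' := by
    rcases hn.rotate.eq_of_adj hd hs.c'b.symm with h | h | h | h
    · exact absurd h.symm hs.cc'
    · exact absurd (h ▸ hs.c'a) hn.naa'
    · exact h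
    · exact absurd h hs.c'a.ne
  subst hd' he' hf'
  rw [hS.touches_iff hd] at hyS
  rw [hQ.touches_iff hd]
  tauto

/-! ### Relative position of two meeting neckties -/

/-- `Q` is a necktie with central triangle `a b c`. -/
def HasCore (Q : Clique (cliqueGraph G)) (a b c : V) : Prop :=
  ∃ a' b' c', IsNecktie Q a b c a' b' c'

theorem HasCore.rotate {Q : Clique (cliqueGraph G)} {a b c : V} (h : HasCore Q a b c) :
    HasCore Q b c a :=
  let ⟨_, _, _, h⟩ := h; ⟨_, _, _, h.rotate⟩

theorem HasCore.swap {Q : Clique (cliqueGraph G)} {a b c : V} (h : HasCore Q a b c) :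
    HasCore Q a c b :=
  let ⟨_, _, _, h⟩ := h; ⟨_, _, _, h.swap⟩

theorem HasCore.unique {P Q : Clique (cliqueGraph G)} {a b c : V} (hP : HasCore P a b c)
    (hQ : HasCore Q a b c) : P = Q := by
  obtain ⟨_, _, _, hP⟩ := hP
  obtain ⟨_, _, _, hQ⟩ := hQ
  exact Subtype.ext (Set.ext fun q => (hP.mem_iff q).trans (hQ.mem_iff q).symm)

/-- Two distinct neckties that meet have central triangles with a common edge, or central
triangles that touch in one vertex and are opposite in its link. -/
theorem IsNecktie.core_cases (hd : DegreeLeFour G) {Q S : Clique (cliqueGraph G)}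
    {a b c a' b' c' d e f : V} (hQ : IsNecktie Q a b c a' b' c') (hS : HasCore S d e f)
    (hne : Q ≠ S) (hmeet : (Q.1 ∩ S.1).Nonempty) :
    (HasCore S a' b c ∨ HasCore S b' c a ∨ HasCore S c' a b) ∨
      (HasCore S a' b c' ∨ HasCore S b' c a' ∨ HasCore S c' a b') := by
  have edge : ∀ {a b c a' b' c' f : V}, IsNecktie Q a b c a' b' c' → HasCore S b c f →
      HasCore S a' b c := by
    rintro a b c a' b' c' f hQ hS
    obtain ⟨_, _, _, h⟩ := id hS
    rcases hQ.neck.rotate.eq_of_adj hd h.neck.ac with rfl | rfl | rfl | rfl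
    · exact absurd h.neck.bc (G.loopless.irrefl _)
    · exact absurd (HasCore.unique ⟨_, _, _, hQ.rotate⟩ hS) hne
    · exact absurd h.neck.bc hQ.neck.ncc'
    · exact hS.rotate.rotate
  have tip : ∀ {a b c a' b' c' f : V}, IsNecktie Q a b c a' b' c' → HasCore S a' b f →
      HasCore S a' b c ∨ HasCore S a' b c' := by
    rintro a b c a' b' c' f hQ hS
    obtain ⟨_, _, _, h⟩ := id hS
    rcases hQ.neck.rotate.eq_of_adj hd h.neck.bc with rfl | rfl | rfl | rfl
    · exact Or.inl hS
    · exact absurd h.neck.ac.symm hQ.neck.naa'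
    · exact Or.inr hS
    · exact absurd h.neck.ac (G.loopless.irrefl _)
  obtain ⟨q, hqQ, hqS⟩ := hmeet
  obtain ⟨x, y, z, hxy, hx, hy, hS'⟩ : ∃ x y z, G.Adj x y ∧ x ∈ q.1 ∧ y ∈ q.1 ∧
      HasCore S x y z := by
    obtain ⟨_, _, _, h⟩ := hS
    rcases (h.mem_iff q).1 hqS with hm | hm | hm
    · exact ⟨d, e, f, h.neck.ab, hm.1, hm.2, _, _, _, h⟩
    · exact ⟨e, f, d, h.neck.bc, hm.1, hm.2, _, _, _, h.rotate⟩
    · exact ⟨d, f, e, h.neck.ac, hm.1, hm.2, _, _, _, h.swap⟩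
  have hS'' : HasCore S y x z := hS'.rotate.swap
  -- A shared clique through `b` and `c` lies in `{a, b, c, a'}`, and it contains a core edge `x y`
  -- of `S`.
  have key : ∀ {a b c a' b' c' : V}, IsNecktie Q a b c a' b' c' → b ∈ q.1 → c ∈ q.1 →
      (HasCore S a' b c ∨ HasCore S b' c a ∨ HasCore S c' a b) ∨
        (HasCore S a' b c' ∨ HasCore S b' c a' ∨ HasCore S c' a b') := by
    intro a b c a' b' c' hQ hb hc
    have hmem : ∀ {w}, w ∈ q.1 → w = b ∨ w = c ∨ w = a ∨ w = a' := by
      intro w hw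
      by_cases h1 : w = b
      · exact Or.inl h1
      by_cases h2 : w = c
      · exact Or.inr (Or.inl h2)
      rcases hQ.neck.rotate.eq_of_adj hd (q.adj hb hw (Ne.symm h1)) with h | h | h | h
      · exact absurd h h2
      · exact Or.inr (Or.inr (Or.inl h))
      · exact absurd (h ▸ q.adj hc hw (Ne.symm h2)) hQ.neck.ncc'
      · exact Or.inr (Or.inr (Or.inr h))
    have hbc : ∀ {f}, HasCore S b c f → HasCore S a' b c := fun h => edge hQ h
    have hca : ∀ {f}, HasCore S c a f → HasCore S b' c a := fun h => edge hQ.rotate h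
    have hab : ∀ {f}, HasCore S a b f → HasCore S c' a b := fun h => edge hQ.rotate.rotate h
    have hb' : ∀ {f}, HasCore S a' b f → HasCore S a' b c ∨ HasCore S a' b c' := fun h => tip hQ h
    have hc' : ∀ {f}, HasCore S a' c f → HasCore S a' b c ∨ HasCore S b' c a' := fun h =>
      (tip hQ.swap h).imp HasCore.swap fun h => h.rotate.rotate.swap
    have irrefl := G.loopless.irrefl
    rcases hmem hx with rfl | rfl | rfl | rfl <;> rcases hmem hy with rfl | rfl | rfl | rfl <;>
      first
      | exact absurd hxy (irrefl _)
      | exact Or.inl (Or.inl (hbc (by assumption)))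
      | exact Or.inl (Or.inr (Or.inl (hca (by assumption))))
      | exact Or.inl (Or.inr (Or.inr (hab (by assumption))))
      | exact absurd hxy hQ.neck.naa'
      | exact absurd hxy.symm hQ.neck.naa'
      | exact (hb' (by assumption)).imp Or.inl Or.inl
      | exact (hc' (by assumption)).imp Or.inl fun h => Or.inr (Or.inl h)
  rcases (hQ.mem_iff q).1 hqQ with hm | hm | hm
  · have := key hQ.rotate.rotate hm.1 hm.2
    tauto
  · exact key hQ hm.1 hm.2
  · have := key hQ.rotate hm.2 hm.1
    tauto

/-- The tips of two neckties whose central triangles touch in the vertex `b`. -/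
theorem IsNecktie.exists_of_core_opposite (hd : DegreeLeFour G) (hO : NoOctahedron G)
    {Q S : Clique (cliqueGraph G)} {a b c a' b' c' : V} (hQ : IsNecktie Q a b c a' b' c')
    (hS : HasCore S a' b c') :
    ∃ y, IsNecktie S a' b c' a y c ∧ y ≠ a ∧ y ≠ b ∧ y ≠ c ∧ y ≠ a' ∧ y ≠ b' ∧ y ≠ c' := by
  obtain ⟨x, y, z, h⟩ := hS
  have hn := hQ.neck
  have hs := h.neck
  have hx : x = a := by
    rcases hn.rotate.eq_of_adj hd hs.a'b.symm with h | h | h | h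
    · exact absurd (h ▸ hs.a'c) hn.ncc'
    · exact h
    · exact absurd h hs.a'c.ne
    · exact absurd h.symm hs.aa'
  have hz : z = c := by
    rcases hn.rotate.eq_of_adj hd hs.c'b.symm with h | h | h | h
    · exact h
    · exact absurd (h ▸ hs.c'a) hn.naa'
    · exact absurd h.symm hs.cc'
    · exact absurd h hs.c'a.ne
  subst hx hz
  refine ⟨y, h, ?_, hs.bb'.symm, ?_, hs.b'a.ne, ?_, hs.b'c.ne⟩
  · rintro rfl; exact hn.naa' hs.b'a
  · rintro rfl; exact hn.ncc' hs.b'c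
  · rintro rfl; exact hO _ _ _ _ _ _ hn ⟨hs.b'a.symm, hs.b'c, hs.ac⟩

/-- The neck of `S` already uses up the four neighbours of `a'` and of `c'`, and `b'` is not among
them. -/
theorem IsNecktie.not_adj_of_core_opposite (hd : DegreeLeFour G) (hO : NoOctahedron G)
    {Q S : Clique (cliqueGraph G)} {a b c a' b' c' : V} (hQ : IsNecktie Q a b c a' b' c')
    (hS : HasCore S a' b c') : ¬ G.Adj b' c' ∧ ¬ G.Adj a' b' := by
  obtain ⟨y, h, -, -, -, -, hyb', -⟩ := hQ.exists_of_core_opposite hd hO hS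
  have hn := hQ.neck
  have hs := h.neck
  constructor
  · intro hadj
    rcases hs.rotate.rotate.eq_of_adj hd hadj.symm with h | h | h | h
    · exact hn.naa' (h ▸ hn.b'a.symm)
    · exact hn.bb' h.symm
    · exact hn.b'a.ne h
    · exact hyb' h.symm
  · intro hadj
    rcases hs.eq_of_adj hd hadj with h | h | h | h
    · exact hn.bb' h.symm
    · exact hn.ncc' (h ▸ hn.b'c.symm)
    · exact hyb' h.symm
    · exact hn.b'c.ne h

/-- A star that meets two neckties whose central triangles touch in one vertex meets everything
that meets the two neckties. -/
theorem inter_nonempty_of_core_opposite [Finite V] (hd : DegreeLeFour G) (hO : NoOctahedron G)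
    {Q S R P : Clique (cliqueGraph G)} {a b c a' b' c' v : V} (hQ : IsNecktie Q a b c a' b' c')
    (hS : HasCore S a' b c') (hR : IsStar R v) (hQv : Touches Q v) (hSv : Touches S v)
    (hPQ : (P.1 ∩ Q.1).Nonempty) (hPS : (P.1 ∩ S.1).Nonempty) : (P.1 ∩ R.1).Nonempty := by
  obtain ⟨hbc', hab'⟩ := hQ.not_adj_of_core_opposite hd hO hS
  obtain ⟨y, hS, hya, hyb, hyc, hya', hyb', hyc'⟩ := hQ.exists_of_core_opposite hd hO hS
  have hn := hQ.neck
  have hs := hS.neck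
  have hSb' : ¬ Touches S b' := by
    rw [hS.touches_iff hd]
    rintro (h | h | h | h | h | h)
    · exact hn.naa' (h ▸ hn.b'a.symm)
    · exact hn.bb' h.symm
    · exact hn.ncc' (h ▸ hn.b'c.symm)
    · exact hn.b'a.ne h
    · exact hyb' h.symm
    · exact hn.b'c.ne h
  -- A star at `a`, `c`, `a'` or `c'` would need a closed link, hence one of the missing edges
  -- `b'c'`, `a'b'`, `cy`, `ay`; and `S` does not touch `b'`.
  have hv : v = b := by
    rcases (hQ.touches_iff hd).1 hQv with rfl | rfl | rfl | rfl | rfl | rfl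
    · exact absurd (hR.adj_of_neck hd hn) hbc'
    · rfl
    · exact absurd (hR.adj_of_neck hd hn.rotate.rotate) hab'
    · have := hn.rotate.rotate.eq_of_adj hd (hR.adj_of_neck hd hs).symm
      tauto
    · exact absurd hSv hSb'
    · have := hn.eq_of_adj hd (hR.adj_of_neck hd hs.rotate.rotate)
      tauto
  subst hv
  rw [hR.inter_nonempty_iff]
  by_contra hcon
  obtain ⟨q, hqP, hqQ⟩ := hPQ
  -- Every vertex touched by `Q` except `b'` is equal or adjacent to the centre of `R`. But a star
  -- at `b'` misses `S`, and a necktie has two centres in `q`.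
  have hcenter : ∀ x ∈ q.1, IsCenter P x → x = b' := by
    intro x hx hxP
    have hfar : ¬ (x = v ∨ G.Adj x v) := fun h => hcon (touches_of_center hd hxP h)
    rcases (hQ.touches_iff hd).1 ⟨q, hqQ, hx⟩ with rfl | rfl | rfl | rfl | rfl | rfl
    · exact absurd (Or.inr hn.ab) hfar
    · exact absurd (Or.inl rfl) hfar
    · exact absurd (Or.inr hn.bc.symm) hfar
    · exact absurd (Or.inr hn.a'b) hfar
    · rfl
    · exact absurd (Or.inr hn.c'b) hfar
  rcases exists_isStar_or_isNecktie hd hO P with ⟨w, hw⟩ | ⟨_, _, _, _, _, _, h⟩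
  · obtain rfl := hcenter w ((hw q).1 hqP) (Or.inl hw)
    rw [Set.inter_comm, hw.inter_nonempty_iff] at hPS
    exact hSb' hPS
  · obtain ⟨x, y, hxy, hx, hy, hxP, hyP⟩ := h.exists_pair hqP
    exact hxy ((hcenter x hx hxP).trans (hcenter y hy hyP).symm)

/-- Two meeting neckties, one of which is missed by something that meets the other, have central
triangles that touch in one vertex. -/
theorem IsNecktie.core_opposite_cases [Finite V] (hd : DegreeLeFour G) (hO : NoOctahedron G)
    {Q S P : Clique (cliqueGraph G)} {a b c a' b' c' d e f : V}
    (hQ : IsNecktie Q a b c a' b' c') (hS : HasCore S d e f) (hne : Q ≠ S)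
    (hmeet : (Q.1 ∩ S.1).Nonempty) (hPS : (P.1 ∩ S.1).Nonempty)
    (hPQ : ¬ (P.1 ∩ Q.1).Nonempty) :
    HasCore S a' b c' ∨ HasCore S b' c a' ∨ HasCore S c' a b' := by
  rcases hQ.core_cases hd hS hne hmeet with (h | h | h) | h
  · obtain ⟨_, _, _, h⟩ := h
    exact absurd (inter_nonempty_of_common_edge hd hO hQ h hPS) hPQ
  · obtain ⟨_, _, _, h⟩ := h
    exact absurd (inter_nonempty_of_common_edge hd hO hQ.rotate h hPS) hPQ
  · obtain ⟨_, _, _, h⟩ := h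
    exact absurd (inter_nonempty_of_common_edge hd hO hQ.rotate.rotate h hPS) hPQ
  · exact h

/-- Both `S` and `R` are opposite to `Q` at a core vertex. Such a position makes two tips of `Q`
adjacent and forbids the other two tip edges, so both use the same core vertex and have the same
core. -/
theorem not_three_neckties [Finite V] (hd : DegreeLeFour G) (hO : NoOctahedron G)
    {Q S R P : Clique (cliqueGraph G)} {a b c a' b' c' d e f x y z : V}
    (hQ : IsNecktie Q a b c a' b' c') (hS : HasCore S d e f) (hR : HasCore R x y z)
    (hQS : Q ≠ S) (hQR : Q ≠ R) (hSR : S ≠ R) (mQS : (Q.1 ∩ S.1).Nonempty)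
    (mQR : (Q.1 ∩ R.1).Nonempty) (hPS : (P.1 ∩ S.1).Nonempty) (hPR : (P.1 ∩ R.1).Nonempty)
    (hPQ : ¬ (P.1 ∩ Q.1).Nonempty) : False := by
  have adj : ∀ {T : Clique (cliqueGraph G)} {x y z : V}, HasCore T x y z → G.Adj x z :=
    fun ⟨_, _, _, h⟩ => h.neck.ac
  rcases hQ.core_opposite_cases hd hO hS hQS mQS hPS hPQ with h | h | h
  · obtain ⟨h1, h2⟩ := hQ.not_adj_of_core_opposite hd hO h
    rcases hQ.core_opposite_cases hd hO hR hQR mQR hPR hPQ with h' | h' | h'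
    · exact hSR (h.unique h')
    · exact h2 (adj h').symm
    · exact h1 (adj h').symm
  · obtain ⟨h1, h2⟩ := hQ.rotate.not_adj_of_core_opposite hd hO h
    rcases hQ.core_opposite_cases hd hO hR hQR mQR hPR hPQ with h' | h' | h'
    · exact h1 (adj h').symm
    · exact hSR (h.unique h')
    · exact h2 (adj h').symm
  · obtain ⟨h1, h2⟩ := hQ.rotate.rotate.not_adj_of_core_opposite hd hO h
    rcases hQ.core_opposite_cases hd hO hR hQR mQR hPR hPQ with h' | h' | h'
    · exact h2 (adj h').symm
    · exact h1 (adj h').symm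
    · exact hSR (h.unique h')

/-- The role of `P` is only to exclude cores with a common edge. -/
theorem inter_nonempty_of_two_neckties [Finite V] (hd : DegreeLeFour G) (hO : NoOctahedron G)
    {Q S R P P' : Clique (cliqueGraph G)} {a b c a' b' c' d e f v : V}
    (hQ : IsNecktie Q a b c a' b' c') (hS : HasCore S d e f) (hR : IsStar R v)
    (hQS : Q ≠ S) (mQS : (Q.1 ∩ S.1).Nonempty) (mQR : (Q.1 ∩ R.1).Nonempty)
    (mSR : (S.1 ∩ R.1).Nonempty) (hPS : (P.1 ∩ S.1).Nonempty) (hPQ : ¬ (P.1 ∩ Q.1).Nonempty)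
    (hQ' : (P'.1 ∩ Q.1).Nonempty) (hS' : (P'.1 ∩ S.1).Nonempty) : (P'.1 ∩ R.1).Nonempty := by
  rw [hR.inter_nonempty_iff] at mQR mSR
  rcases hQ.core_opposite_cases hd hO hS hQS mQS hPS hPQ with h | h | h
  · exact inter_nonempty_of_core_opposite hd hO hQ h hR mQR mSR hQ' hS'
  · exact inter_nonempty_of_core_opposite hd hO hQ.rotate h hR mQR mSR hQ' hS'
  · exact inter_nonempty_of_core_opposite hd hO hQ.rotate.rotate h hR mQR mSR hQ' hS'

/-! ### The Hajós configuration in K²(G) -/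

/-- `K²(G)` has no Hajós subgraph whose tips all miss the opposite vertices. -/
theorem cliqueGraph2_hajos [Finite V] (hd : DegreeLeFour G) (hO : NoOctahedron G)
    {Q₁ Q₂ Q₃ P₁ P₂ P₃ : Clique (cliqueGraph G)} (h12 : Q₁ ≠ Q₂) (h23 : Q₂ ≠ Q₃) (h13 : Q₁ ≠ Q₃)
    (m12 : (Q₁.1 ∩ Q₂.1).Nonempty) (m23 : (Q₂.1 ∩ Q₃.1).Nonempty)
    (m13 : (Q₁.1 ∩ Q₃.1).Nonempty) (p12 : (P₁.1 ∩ Q₂.1).Nonempty)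
    (p13 : (P₁.1 ∩ Q₃.1).Nonempty) (p21 : (P₂.1 ∩ Q₁.1).Nonempty)
    (p23 : (P₂.1 ∩ Q₃.1).Nonempty) (p31 : (P₃.1 ∩ Q₁.1).Nonempty)
    (p32 : (P₃.1 ∩ Q₂.1).Nonempty) :
    (P₁.1 ∩ Q₁.1).Nonempty ∨ (P₂.1 ∩ Q₂.1).Nonempty ∨ (P₃.1 ∩ Q₃.1).Nonempty := by
  by_contra! hcon
  simp only [← Set.not_nonempty_iff_eq_empty] at hcon
  obtain ⟨n1, n2, n3⟩ := hcon
  have starAdj : ∀ {P Q : Clique (cliqueGraph G)} {u v : V}, IsStar P u → IsStar Q v → P ≠ Q →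
      (P.1 ∩ Q.1).Nonempty → G.Adj u v := by
    intro P Q u v hP hQ hne hm
    rw [hQ.inter_nonempty_iff, hP.touches_iff] at hm
    refine hm.resolve_left ?_
    rintro rfl
    exact hne (Subtype.ext (Set.ext fun q => (hP q).trans (hQ q).symm))
  have one : ∀ {Q Q₂ Q₃ P : Clique (cliqueGraph G)} {u v : V},
      (∃ a b c a' b' c', IsNecktie Q a b c a' b' c') → IsStar Q₂ u → IsStar Q₃ v → Q₂ ≠ Q₃ →
      (Q.1 ∩ Q₂.1).Nonempty → (Q.1 ∩ Q₃.1).Nonempty → (Q₂.1 ∩ Q₃.1).Nonempty →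
      (P.1 ∩ Q₂.1).Nonempty → (P.1 ∩ Q₃.1).Nonempty → (P.1 ∩ Q.1).Nonempty := by
    rintro Q Q₂ Q₃ P u v ⟨a, b, c, a', b', c', hQ⟩ h2 h3 hne m2 m3 m p2 p3
    exact inter_nonempty_of_two_stars hd hO hQ h2 h3 (starAdj h2 h3 hne m)
      (h2.inter_nonempty_iff.1 m2) (h3.inter_nonempty_iff.1 m3) (h2.inter_nonempty_iff.1 p2)
      (h3.inter_nonempty_iff.1 p3)
  have symm : ∀ {P Q : Clique (cliqueGraph G)}, (P.1 ∩ Q.1).Nonempty → (Q.1 ∩ P.1).Nonempty :=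
    fun h => by rwa [Set.inter_comm]
  rcases exists_isStar_or_isNecktie hd hO Q₁ with ⟨u, s1⟩ | t1 <;>
    rcases exists_isStar_or_isNecktie hd hO Q₂ with ⟨v, s2⟩ | t2 <;>
    rcases exists_isStar_or_isNecktie hd hO Q₃ with ⟨w, s3⟩ | t3
  · have uv := starAdj s1 s2 h12 m12
    have vw := starAdj s2 s3 h23 m23
    have uw := starAdj s1 s3 h13 m13
    -- A centre of `P` descends to G as a tip over the edge `y z`, so three stars with their tips
    -- give a neck of G.
    have tip : ∀ {P Q Q' Q'' : Clique (cliqueGraph G)} {x y z : V}, IsStar Q x → IsStar Q' y →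
        IsStar Q'' z → G.Adj y z → G.Adj x y → G.Adj x z → (P.1 ∩ Q'.1).Nonempty →
        (P.1 ∩ Q''.1).Nonempty → ¬ (P.1 ∩ Q.1).Nonempty →
        ∃ t, G.Adj t y ∧ G.Adj t z ∧ ¬ G.Adj x t ∧ x ≠ t := by
      intro P Q Q' Q'' x y z hx hy hz yz xy xz py pz px
      rw [hy.inter_nonempty_iff] at py
      rw [hz.inter_nonempty_iff] at pz
      rw [hx.inter_nonempty_iff] at px
      obtain ⟨t, hty, htz, ht⟩ := exists_center hd hO yz py pz
      have htx : ¬ (t = x ∨ G.Adj t x) := fun h => px (touches_of_center hd ht h)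
      refine ⟨t, hty.resolve_left ?_, htz.resolve_left ?_, fun h => htx (Or.inr h.symm),
        fun h => htx (Or.inl h.symm)⟩
      · rintro rfl; exact htx (Or.inr xy.symm)
      · rintro rfl; exact htx (Or.inr xz.symm)
    obtain ⟨a, av, aw, nua, ua⟩ := tip s1 s2 s3 vw uv uw p12 p13 n1
    obtain ⟨b, bu, bw, nvb, vb⟩ := tip s2 s1 s3 uw uv.symm vw p21 p23 n2
    obtain ⟨c, cu, cv, nwc, wc⟩ := tip s3 s1 s2 uv uw.symm vw.symm p31 p32 n3
    exact not_three_stars hd hO s1 s2 s3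
      ⟨uv, vw, uw, av, aw, bu, bw, cu, cv, nua, nvb, nwc, ua, vb, wc⟩
  · exact n3 (one t3 s1 s2 h12 (symm m13) (symm m23) m12 p31 p32)
  · exact n2 (one t2 s1 s3 h13 (symm m12) m23 m13 p21 p23)
  · obtain ⟨_, _, _, _, _, _, t2⟩ := t2
    obtain ⟨_, _, _, t3⟩ := t3
    exact n1 (inter_nonempty_of_two_neckties hd hO t2 t3 s1 h23 m23 (symm m12) (symm m13) p23 n2
      p12 p13)
  · exact n1 (one t1 s2 s3 h23 m12 m13 m23 p12 p13)
  · obtain ⟨_, _, _, _, _, _, t1⟩ := t1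
    obtain ⟨_, _, _, t3⟩ := t3
    exact n2 (inter_nonempty_of_two_neckties hd hO t1 t3 s2 h13 m13 m12 (symm m23) p13 n1
      p21 p23)
  · obtain ⟨_, _, _, _, _, _, t1⟩ := t1
    obtain ⟨_, _, _, t2⟩ := t2
    exact n3 (inter_nonempty_of_two_neckties hd hO t1 t2 s3 h12 m12 m13 m23 p12 n1 p31 p32)
  · obtain ⟨_, _, _, _, _, _, t1⟩ := t1
    obtain ⟨_, _, _, t2⟩ := t2
    obtain ⟨_, _, _, t3⟩ := t3
    exact not_three_neckties hd hO t1 t2 t3 h12 h13 h23 m12 m13 p12 p13 n1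

end CliqueOperator

theorem mainTheorem2 {V : Type*} [Fintype V] (G : SimpleGraph V) [DecidableRel G.Adj]
    (hconn : G.Connected) (hdeg : G.maxDegree ≤ 4)
    (hoct : ¬ Nonempty (G ≃g CliqueOperator.octahedron)) :
    (∀ Q : SimpleGraph.Copy CliqueOperator.hajosGraph (CliqueOperator.cliqueGraph2 G),
      (CliqueOperator.cliqueGraph2 G).Adj (Q 3) (Q 2) ∨
      (CliqueOperator.cliqueGraph2 G).Adj (Q 4) (Q 0) ∨
      (CliqueOperator.cliqueGraph2 G).Adj (Q 5) (Q 1)) ∧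
    CliqueOperator.IsHereditaryHelly (CliqueOperator.cliqueGraph2 G) := by
  have hd := CliqueOperator.degreeLeFour_of_maxDegree_le hdeg
  have hO := CliqueOperator.noOctahedron_of_not_iso hd hconn hoct
  suffices h : ∀ Q : SimpleGraph.Copy CliqueOperator.hajosGraph (CliqueOperator.cliqueGraph2 G),
      (CliqueOperator.cliqueGraph2 G).Adj (Q 3) (Q 2) ∨
      (CliqueOperator.cliqueGraph2 G).Adj (Q 4) (Q 0) ∨
      (CliqueOperator.cliqueGraph2 G).Adj (Q 5) (Q 1) from
    ⟨h, CliqueOperator.isHereditaryHelly_of_hajos h⟩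
  intro Q
  have hinj : Function.Injective Q := Q.injective
  have hadj : ∀ {i j}, CliqueOperator.hajosGraph.Adj i j →
      ((Q i).1 ∩ (Q j).1).Nonempty := fun h => (Q.toHom.map_adj h).2
  -- Tips are matched with the vertices they face: 4 with 0, 5 with 1, 3 with 2.
  rcases CliqueOperator.cliqueGraph2_hajos hd hO (Q₁ := Q 0) (Q₂ := Q 1) (Q₃ := Q 2)
      (P₁ := Q 4) (P₂ := Q 5) (P₃ := Q 3) (hinj.ne (by decide)) (hinj.ne (by decide))
      (hinj.ne (by decide)) (hadj (by simp [CliqueOperator.hajosGraph]))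
      (hadj (by simp [CliqueOperator.hajosGraph])) (hadj (by simp [CliqueOperator.hajosGraph]))
      (hadj (by simp [CliqueOperator.hajosGraph])) (hadj (by simp [CliqueOperator.hajosGraph]))
      (hadj (by simp [CliqueOperator.hajosGraph])) (hadj (by simp [CliqueOperator.hajosGraph]))
      (hadj (by simp [CliqueOperator.hajosGraph])) (hadj (by simp [CliqueOperator.hajosGraph]))
    with h | h | h
  · exact Or.inr (Or.inl ⟨hinj.ne (by decide), h⟩)
  · exact Or.inr (Or.inr ⟨hinj.ne (by decide), h⟩)
  · exact Or.inl ⟨hinj.ne (by decide), h⟩
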